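/- Let $d,\nu\in\mathbb N$, $T>0$, and let $\Lambda\subset\mathbb R^\nu$ be nonempty, compact and convex. Let $\alpha\mapsto A(\alpha)\in\mathbb R^{d\times d}$ and $\alpha\mapsto b(\alpha)\in\mathbb R^d$ be continuously differentiable on an open neighbourhood of $\Lambda$, let $\bar x\in\mathbb R^d$, and let $\psi:\mathbb R^d\to\mathbb R$ be convex and continuously differentiable such that $C=\{\xi:\psi(\xi)\le 0\}$ is compact. A control is a function $u\in L^\infty([0,T];\mathbb R)$ with $u(t)\in[-1,1]$ for a.e. $t$; for $\alpha\in\Lambda$ let $x(\cdot;\alpha)$ be the absolutely continuous solution of $$\dot x(t;\alpha)=A(\alpha)x(t;\alpha)+b(\alpha)u(t)\ \text{ for a.e. } t\in[0,T],\qquad x(0;\alpha)=\bar x .$$ The control is feasible if $x(T;\alpha)\in C$ for all $\alpha\in\Lambda$, and $L^1$-optimal if it is feasible and minimizes $\int_0^T|u(t)|\,dt$ among all feasible controls. Let $u^*$ be an $L^1$-optimal control with states $x^*(\cdot;\alpha)$, let $\Lambda_{\mathrm a}=\{\alpha\in\Lambda:\psi(x^*(T;\alpha))=0\}$ be the active set,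 and let $N_C(x)=\{v:\langle v,y-x\rangle\le 0\ \text{for all } y\in C\}$ for $x\in C$. A multiplier triple for $u^*$ consists of a scalar $\eta\in[0,1]$, a finite nonnegative Borel measure $\lambda$ on $\Lambda$ and absolutely continuous arcs $p(\cdot;\alpha):[0,T]\to\mathbb R^d$, defined for $\lambda$-a.e. $\alpha$, with $p(T;\cdot)$ $\lambda$-integrable, such that 1. $\eta+\lambda(\Lambda)=1$; 2. for $\lambda$-a.e. $\alpha$, $-\dot p(t;\alpha)=A(\alpha)^{\top}p(t;\alpha)$ for a.e. $t\in[0,T]$; 3. for $\lambda$-a.e. $\alpha$ there is $\mu(\alpha)\ge 0$, with $\mu(\alpha)>0$ only if $\psi(x^*(T;\alpha))=0$, such that $-p(T;\alpha)=\mu(\alpha)\nabla\psi(x^*(T;\alpha))$; 4. $\operatorname{supp}\lambda\subset\Lambda_{\mathrm a}$; 5. for a.e. $t\in[0,T]$, $u^*(t)$ maximizes $v\mapsto\int_\Lambda\langle p(t;\alpha),A(\alpha)x^*(t;\alpha)+b(\alpha)v\rangle\,\lambda(d\alpha)-\eta|v|$ over $v\in[-1,1]$. Its averaged switching function is $\varphi(t)=\int_\Lambda\langle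 p(t;\alpha),b(\alpha)\rangle\,\lambda(d\alpha)$. Then multiplier triples for $u^*$ exist. Moreover, let $(\eta,\lambda,p)$ be any multiplier triple for $u^*$ such that (a) (normality) $\eta>0$; (b) (averaged controllability-like condition) for every measurable and $\lambda$-integrable $v:\Lambda_{\mathrm a}\to\mathbb R^d$ with $v(\alpha)\in N_C(x^*(T;\alpha))$ for all $\alpha\in\Lambda_{\mathrm a}$ that is not $\lambda$-a.e. zero on $\Lambda_{\mathrm a}$ there is $m\in\{1,\dots,d-1\}$ with $$\int_{\Lambda_{\mathrm a}}\langle A(\alpha)^m b(\alpha),v(\alpha)\rangle\,\lambda(d\alpha)\neq 0 .$$ Then $u^*$ is bang-off-bang: for a.e. $t\in[0,T]$ one has $|\varphi(t)|\neq\eta$ and $$u^*(t)=\begin{cases}1&\text{if }\varphi(t)>\eta,\\ 0&\text{if }|\varphi(t)|<\eta,\\ -1&\text{if }\varphi(t)<-\eta.\end{cases}$$ -/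

import Mathlib

open MeasureTheory Set

noncomputable section

namespace RobustHandsOff

/-- The Euclidean space `ℝⁿ`. -/
abbrev E (n : ℕ) : Type := EuclideanSpace ℝ (Fin n)

/-- The normal cone `N_C(x) = {v | ⟪v, y - x⟫ ≤ 0 for all y ∈ C}`. -/
def normalCone {n : ℕ} (C : Set (E n)) (x : E n) : Set (E n) :=
  {v | ∀ y ∈ C, inner ℝ v (y - x) ≤ 0}

/-- The data of the robust optimal control problem: the horizon `T`, the uncertainty set `Λ`, the
matrices `A α` and vectors `b α`, the initial state `xi` and the function `ψ` that defines the
terminal constraint `ψ (x T) ≤ 0`. -/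
structure Problem (d ν : ℕ) where
  T : ℝ
  T_pos : 0 < T
  Λ : Set (E ν)
  Λ_nonempty : Λ.Nonempty
  Λ_compact : IsCompact Λ
  Λ_convex : Convex ℝ Λ
  A : E ν → Matrix (Fin d) (Fin d) ℝ
  b : E ν → E d
  /-- `A` (entry by entry) and `b` are `C¹` on an open neighbourhood of `Λ`. -/
  data_C1 : ∃ O : Set (E ν), IsOpen O ∧ Λ ⊆ O ∧
    (∀ i j, ContDiffOn ℝ 1 (fun α => A α i j) O) ∧ ContDiffOn ℝ 1 b O
  xi : E d
  ψ : E d → ℝ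
  ψ_C1 : ContDiff ℝ 1 ψ
  ψ_convex : ConvexOn ℝ univ ψ
  target_compact : IsCompact {z : E d | ψ z ≤ 0}

namespace Problem

variable {d ν : ℕ} (P : Problem d ν)

/-- The terminal set `C = {z | ψ z ≤ 0}`. -/
def target : Set (E d) := {z | P.ψ z ≤ 0}

/-- Lebesgue measure on `[0, T]`. -/
def timeMeasure : Measure ℝ := volume.restrict (Icc 0 P.T)

/-- The pair `(u, {x(·; α) | α ∈ Λ})` is a process: the control `u` is in `L^∞([0,T])` with values
in `[-1, 1]` almost everywhere and, for every `α ∈ Λ`, the curve `x(·; α)` is absolutely continuous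
on `[0, T]`, starts at `xi` and satisfies `x' = A(α) x + b(α) u` almost everywhere. -/
structure IsControlledPair (u : ℝ → ℝ) (x : E ν → ℝ → E d) : Prop where
  control_memLp : MemLp u ⊤ P.timeMeasure
  control_mem : ∀ᵐ t ∂P.timeMeasure, u t ∈ Icc (-1 : ℝ) 1
  state_ac : ∀ α ∈ P.Λ, AbsolutelyContinuousOnInterval (x α) 0 P.T
  state_init : ∀ α ∈ P.Λ, x α 0 = P.xi
  state_ode : ∀ α ∈ P.Λ, ∀ᵐ t ∂P.timeMeasure,
    HasDerivAt (x α) (Matrix.toEuclideanCLM (𝕜 := ℝ) (P.A α) (x α t) + u t • P.b α) t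

/-- A process is feasible if `x(T; α) ∈ C` for all `α ∈ Λ`. -/
structure IsFeasible (u : ℝ → ℝ) (x : E ν → ℝ → E d) : Prop extends P.IsControlledPair u x where
  terminal : ∀ α ∈ P.Λ, x α P.T ∈ P.target

/-- The `L¹` objective. -/
def cost (u : ℝ → ℝ) : ℝ := ∫ t in (0 : ℝ)..P.T, |u t|

/-- A feasible process that minimizes the `L¹` objective over all feasible processes. -/
def IsL1Optimal (u : ℝ → ℝ) (x : E ν → ℝ → E d) : Prop :=
  P.IsFeasible u x ∧
    ∀ (w : ℝ → ℝ) (y : E ν → ℝ → E d), P.IsFeasible w y → P.cost u ≤ P.cost w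

/-- The active set `{α ∈ Λ | ψ(x(T; α)) = 0}`. -/
def activeSet (x : E ν → ℝ → E d) : Set (E ν) := {α ∈ P.Λ | P.ψ (x α P.T) = 0}

/-- The averaged switching function `φ(t) = ∫_Λ ⟪p(t; α), b(α)⟫ dlam(α)`. -/
def switching (lam : Measure (E ν)) (p : E ν → ℝ → E d) (t : ℝ) : ℝ :=
  ∫ α in P.Λ, inner ℝ (p α t) (P.b α) ∂lam

/-- `(η, lam, p)` is a multiplier triple for the process `(u, x)` in the sense of the robust maximum
principle. The measure `lam` on `Λ` is represented by a finite Borel measure on `ℝ^ν` that vanishes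
off `Λ`; such a measure is automatically Radon. -/
structure IsMultiplier (u : ℝ → ℝ) (x : E ν → ℝ → E d)
    (η : ℝ) (lam : Measure (E ν)) (p : E ν → ℝ → E d) : Prop where
  η_mem : η ∈ Icc (0 : ℝ) 1
  finite : IsFiniteMeasure lam
  null_compl : lam P.Λᶜ = 0
  /-- Nontriviality and normalization. -/
  normalized : η + lam.real P.Λ = 1
  /-- The costate arcs are absolutely continuous. -/
  costate_ac : ∀ᵐ α ∂lam, AbsolutelyContinuousOnInterval (p α) 0 P.T
  /-- The terminal costate is integrable, so that the averages over `α` are meaningful. -/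
  costate_integrable : Integrable (fun α => p α P.T) lam
  /-- The adjoint equation `-p' = A(α)ᵀ p`. -/
  adjoint : ∀ᵐ α ∂lam, ∀ᵐ t ∂P.timeMeasure,
    HasDerivAt (p α) (-(Matrix.toEuclideanCLM (𝕜 := ℝ) (P.A α).transpose (p α t))) t
  /-- Transversality `-p(T; α) = μ(α) ∇ψ(x(T; α))` with `μ(α) ≥ 0`, and complementarity. -/
  transversality : ∀ᵐ α ∂lam, ∃ μ : ℝ, 0 ≤ μ ∧
    -(p α P.T) = μ • gradient P.ψ (x α P.T) ∧ (0 < μ → P.ψ (x α P.T) = 0)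
  /-- The measure is supported on the active set. -/
  support : lam.support ⊆ P.activeSet x
  /-- Maximization of the averaged Hamiltonian. -/
  maximization : ∀ᵐ t ∂P.timeMeasure, u t ∈ Icc (-1 : ℝ) 1 ∧
    IsMaxOn (fun v : ℝ =>
      (∫ α in P.Λ, inner ℝ (p α t)
        (Matrix.toEuclideanCLM (𝕜 := ℝ) (P.A α) (x α t) + v • P.b α) ∂lam) - η * |v|)
      (Icc (-1 : ℝ) 1) (u t)

/-- The averaged controllability-like condition: each measurable (and integrable, so that the
averages exist) selection `v(α) ∈ N_C(x(T; α))` on the active set that does not vanish almost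
everywhere there satisfies `∫ ⟪A(α)^m b(α), v(α)⟫ dlam(α) ≠ 0`, the integral being over the active
set, for some `m ∈ {1, …, d - 1}`. -/
def AveragedControllability (x : E ν → ℝ → E d) (lam : Measure (E ν)) : Prop :=
  ∀ v : E ν → E d, Measurable v → Integrable v (lam.restrict (P.activeSet x)) →
    (∀ α ∈ P.activeSet x, v α ∈ normalCone P.target (x α P.T)) →
    ¬ (∀ᵐ α ∂lam.restrict (P.activeSet x), v α = 0) →
    ∃ m : ℕ, 1 ≤ m ∧ m + 1 ≤ d ∧
      ∫ α in P.activeSet x,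
        inner ℝ (Matrix.toEuclideanCLM (𝕜 := ℝ) (P.A α ^ m) (P.b α)) (v α) ∂lam ≠ 0

end Problem

end RobustHandsOff

end

/-! Bang-off-bang structure. The matrices `A(α)` form one element `a` of the Banach algebra of
continuous operator-valued functions on `Λ` (`opMap`), and evaluation at `α` commutes with `exp`.
Solving the adjoint equation gives `φ(t) = ∫ ⟪p(T;α), exp((T-t)A(α)) b(α)⟫ dλ = l(exp((T-t)a))` for
a continuous linear functional `l` (`pairing`), so `φ` is real analytic. If `φ = ±η` on a set of
positive measure, then `φ` is constant, and its derivatives at `T` give `l(a^m) = 0` for all `m ≥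
1`. Since `-p(T;α)` is normal to `C`, condition (b) forces `p(T;·) = 0` a.e., so `φ = 0`, against `η
> 0`. Off the level sets, maximizing `φ v - η|v|` determines `u`.

Existence. The terminal states are affine in the control, and the cost and `ψ` are convex.
Optimality is therefore a separation statement in `ℝ × C(Λ)`: Hahn–Banach and Riesz yield `η` and a
measure (`exists_fritzJohn_multiplier`). Linearizing `ψ` alone (`linearized_nonneg`) and rewriting
the variation of the state through `φ` (`integral_inner_variation`) gives an integrated inequality;
a single competitor makes it pointwise (`ae_maximizes`). -/

noncomputable section

namespace RobustHandsOff

/-! ### Linear equations with absolutely continuous solutions. -/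

section LinearODE

variable {F : Type*} [NormedAddCommGroup F] [NormedSpace ℝ F]

/-- The increment splits as in the product rule, and both factors are bounded because they are
absolutely continuous. -/
theorem absolutelyContinuousOnInterval_clm_apply {f : ℝ → F →L[ℝ] F} {g : ℝ → F} {a b : ℝ}
    (hf : AbsolutelyContinuousOnInterval f a b) (hg : AbsolutelyContinuousOnInterval g a b) :
    AbsolutelyContinuousOnInterval (fun t => f t (g t)) a b := by
  obtain ⟨C, hC⟩ := hf.exists_bound
  obtain ⟨D, hD⟩ := hg.exists_bound
  unfold AbsolutelyContinuousOnInterval at hf hg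
  refine squeeze_zero' (Filter.Eventually.of_forall
    fun _ => Finset.sum_nonneg fun i hi => dist_nonneg) ?_
    (by simpa using (hg.const_mul C).add (hf.const_mul D))
  rw [Filter.eventually_inf_principal]
  filter_upwards with ⟨n, I⟩ hnI
  simp only [Finset.mul_sum, ← Finset.sum_add_distrib]
  refine Finset.sum_le_sum fun i hi => ?_
  have h1 := hC _ (hnI.left i hi).left
  have h2 := hD _ (hnI.left i hi).right
  rw [dist_eq_norm, dist_eq_norm, dist_eq_norm]
  calc ‖f (I i).1 (g (I i).1) - f (I i).2 (g (I i).2)‖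
      = ‖f (I i).1 (g (I i).1 - g (I i).2) + (f (I i).1 - f (I i).2) (g (I i).2)‖ := by
        congr 1; simp [map_sub]
    _ ≤ ‖f (I i).1‖ * ‖g (I i).1 - g (I i).2‖ + ‖f (I i).1 - f (I i).2‖ * ‖g (I i).2‖ :=
        (norm_add_le _ _).trans
          (add_le_add (ContinuousLinearMap.le_opNorm _ _) (ContinuousLinearMap.le_opNorm _ _))
    _ ≤ C * ‖g (I i).1 - g (I i).2‖ + D * ‖f (I i).1 - f (I i).2‖ := by
        rw [mul_comm D]; gcongr

/-- The variation of constants formula. -/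
def duhamel (L : F →L[ℝ] F) (u : ℝ → ℝ) (b ξ : F) (t : ℝ) : F :=
  NormedSpace.exp (t • L) (ξ + ∫ s in (0 : ℝ)..t, u s • NormedSpace.exp ((-s) • L) b)

theorem duhamel_zero (u : ℝ → ℝ) (L : F →L[ℝ] F) (b ξ : F) : duhamel L u b ξ 0 = ξ := by
  simp [duhamel, NormedSpace.exp_zero]

theorem absolutelyContinuousOnInterval_integral_of_bound {T C : ℝ} {f : ℝ → F} (hT : 0 ≤ T)
    (hf : IntervalIntegrable f volume 0 T)
    (hb : ∀ᵐ t ∂volume.restrict (Icc 0 T), ‖f t‖ ≤ C) :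
    AbsolutelyContinuousOnInterval (fun t => ∫ s in (0 : ℝ)..t, f s) 0 T := by
  have hL : LipschitzOnWith C.toNNReal (fun t => ∫ s in (0 : ℝ)..t, f s) (uIcc 0 T) := by
    refine LipschitzOnWith.of_dist_le_mul fun s hs t ht => ?_
    rw [dist_eq_norm, intervalIntegral.integral_interval_sub_left
      (hf.mono_set (uIcc_subset_uIcc left_mem_uIcc hs))
      (hf.mono_set (uIcc_subset_uIcc left_mem_uIcc ht)), Real.dist_eq]
    refine intervalIntegral.norm_integral_le_of_norm_le_const_ae ?_
    rw [ae_restrict_iff' measurableSet_Icc] at hb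
    filter_upwards [hb] with r hr hr'
    have : r ∈ uIcc 0 T := uIcc_subset_uIcc ht hs (uIoc_subset_uIcc hr')
    rw [uIcc_of_le hT] at this
    exact (hr this).trans (Real.le_coe_toNNReal C)
  exact hL.absolutelyContinuousOnInterval

variable [CompleteSpace F]

theorem exp_neg_smul_mul_exp_smul {𝔸 : Type*} [NormedRing 𝔸] [NormedAlgebra ℝ 𝔸] [CompleteSpace 𝔸]
    (L : 𝔸) (t : ℝ) : NormedSpace.exp ((-t) • L) * NormedSpace.exp (t • L) = 1 := by
  let +nondep : NormedAlgebra ℚ 𝔸 := .restrictScalars ℚ ℝ 𝔸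
  rw [← NormedSpace.exp_add_of_commute, neg_smul, neg_add_cancel, NormedSpace.exp_zero]
  exact ((Commute.refl L).smul_left _).smul_right _

theorem exp_smul_mul_exp_neg_smul {𝔸 : Type*} [NormedRing 𝔸] [NormedAlgebra ℝ 𝔸] [CompleteSpace 𝔸]
    (L : 𝔸) (t : ℝ) : NormedSpace.exp (t • L) * NormedSpace.exp ((-t) • L) = 1 := by
  simpa using exp_neg_smul_mul_exp_smul L (-t)

theorem exp_smul_apply_exp_neg_smul_apply (L : F →L[ℝ] F) (t : ℝ) (z : F) :
    NormedSpace.exp (t • L) (NormedSpace.exp ((-t) • L) z) = z := by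
  simpa using congrArg (fun M : F →L[ℝ] F => M z) (exp_smul_mul_exp_neg_smul L t)

theorem exp_zero_smul {𝔸 : Type*} [NormedRing 𝔸] [NormedAlgebra ℝ 𝔸] (L : 𝔸) :
    NormedSpace.exp ((0 : ℝ) • L) = 1 := by
  rw [zero_smul, NormedSpace.exp_zero]

theorem continuous_exp_smul {𝔸 : Type*} [NormedRing 𝔸] [NormedAlgebra ℝ 𝔸] [CompleteSpace 𝔸]
    (L : 𝔸) : Continuous fun t : ℝ => NormedSpace.exp (t • L) :=
  (differentiable_exp_smul_const ℝ L).continuous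

theorem contDiff_exp_smul {𝔸 : Type*} [NormedRing 𝔸] [NormedAlgebra ℝ 𝔸] [CompleteSpace 𝔸]
    (L : 𝔸) : ContDiff ℝ 1 fun t : ℝ => NormedSpace.exp (t • L) := by
  rw [contDiff_one_iff_deriv]
  refine ⟨differentiable_exp_smul_const ℝ L, ?_⟩
  have : deriv (fun t : ℝ => NormedSpace.exp (t • L)) = fun t => NormedSpace.exp (t • L) * L :=
    funext fun t => (hasDerivAt_exp_smul_const L t).deriv
  rw [this]
  exact (continuous_exp_smul L).mul continuous_const

theorem absolutelyContinuousOnInterval_exp_smul (L : F →L[ℝ] F) (a b : ℝ) :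
    AbsolutelyContinuousOnInterval (fun t : ℝ => NormedSpace.exp (t • L)) a b :=
  (contDiff_exp_smul L).contDiffOn.absolutelyContinuousOnInterval

variable {T : ℝ} {u : ℝ → ℝ}

theorem intervalIntegrable_smul_of_control (hT : 0 ≤ T)
    (hu : AEStronglyMeasurable u (volume.restrict (Icc 0 T)))
    (hb : ∀ᵐ t ∂volume.restrict (Icc 0 T), u t ∈ Icc (-1 : ℝ) 1)
    {G : Type*} [NormedAddCommGroup G] [NormedSpace ℝ G] {f : ℝ → G} (hf : Continuous f) :
    IntervalIntegrable (fun s => u s • f s) volume 0 T := by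
  rw [intervalIntegrable_iff_integrableOn_Icc_of_le hT]
  have hi : IntegrableOn f (Icc 0 T) := hf.continuousOn.integrableOn_Icc
  refine Integrable.bdd_smul hi 1 hu ?_
  filter_upwards [hb] with t ht
  rw [Real.norm_eq_abs, abs_le]; exact ht

theorem duhamel_absolutelyContinuousOnInterval (hT : 0 ≤ T)
    (hu : AEStronglyMeasurable u (volume.restrict (Icc 0 T)))
    (hb : ∀ᵐ t ∂volume.restrict (Icc 0 T), u t ∈ Icc (-1 : ℝ) 1) (L : F →L[ℝ] F) (b ξ : F) :
    AbsolutelyContinuousOnInterval (duhamel L u b ξ) 0 T := by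
  have hc : Continuous fun s : ℝ => NormedSpace.exp ((-s) • L) b :=
    ((continuous_exp_smul L).comp continuous_neg).clm_apply continuous_const
  obtain ⟨C, hC⟩ := (isCompact_Icc (a := (0 : ℝ)) (b := T)).exists_bound_of_continuousOn
    hc.continuousOn
  refine absolutelyContinuousOnInterval_clm_apply
    (absolutelyContinuousOnInterval_exp_smul L 0 T) ?_
  refine AbsolutelyContinuousOnInterval.fun_add
    (contDiff_const (c := ξ) (n := 1)).contDiffOn.absolutelyContinuousOnInterval ?_
  refine absolutelyContinuousOnInterval_integral_of_bound hT (C := C)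
    (intervalIntegrable_smul_of_control hT hu hb hc) ?_
  filter_upwards [hb, ae_restrict_mem measurableSet_Icc] with t ht htm
  rw [norm_smul, Real.norm_eq_abs]
  have h1 : |u t| ≤ 1 := abs_le.2 ht
  have h2 := hC t htm
  nlinarith [norm_nonneg (NormedSpace.exp ((-t) • L) b), abs_nonneg (u t)]

theorem duhamel_hasDerivAt (hT : 0 ≤ T)
    (hu : AEStronglyMeasurable u (volume.restrict (Icc 0 T)))
    (hb : ∀ᵐ t ∂volume.restrict (Icc 0 T), u t ∈ Icc (-1 : ℝ) 1) (L : F →L[ℝ] F) (b ξ : F) :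
    ∀ᵐ t ∂volume.restrict (Icc 0 T),
      HasDerivAt (duhamel L u b ξ) (L (duhamel L u b ξ t) + u t • b) t := by
  have hc : Continuous fun s : ℝ => NormedSpace.exp ((-s) • L) b :=
    ((continuous_exp_smul L).comp continuous_neg).clm_apply continuous_const
  have key := (intervalIntegrable_smul_of_control hT hu hb hc).ae_hasDerivAt_integral
  rw [ae_restrict_iff' measurableSet_Icc]
  filter_upwards [key] with t ht htm
  have h1 := ht (by rwa [uIcc_of_le hT]) 0 left_mem_uIcc
  have h2 := (hasDerivAt_exp_smul_const' L t).clm_apply (h1.const_add ξ)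
  refine h2.congr_deriv ?_
  rw [map_smul, exp_smul_apply_exp_neg_smul_apply]
  rfl

/-- Multiplying the difference of two solutions by the integrating factor `exp(-tL)` gives an
absolutely continuous function with zero derivative a.e., hence a constant, which is zero at the
initial time. -/
theorem eq_duhamel (hT : 0 ≤ T)
    (hu : AEStronglyMeasurable u (volume.restrict (Icc 0 T)))
    (hb : ∀ᵐ t ∂volume.restrict (Icc 0 T), u t ∈ Icc (-1 : ℝ) 1) (L : F →L[ℝ] F) (b : F)
    {x : ℝ → F} (hx : AbsolutelyContinuousOnInterval x 0 T)
    (hd : ∀ᵐ t ∂volume.restrict (Icc 0 T), HasDerivAt x (L (x t) + u t • b) t)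
    {t : ℝ} (ht : t ∈ Icc 0 T) : x t = duhamel L u b (x 0) t := by
  set y := duhamel L u b (x 0) with hy
  have hexp : AbsolutelyContinuousOnInterval (fun t : ℝ => NormedSpace.exp ((-t) • L)) 0 T := by
    have := absolutelyContinuousOnInterval_exp_smul (-L) 0 T
    simpa only [smul_neg, neg_smul] using this
  have hac : AbsolutelyContinuousOnInterval
      (fun t => NormedSpace.exp ((-t) • L) (x t - y t)) 0 T :=
    absolutelyContinuousOnInterval_clm_apply hexp
      (hx.fun_sub (duhamel_absolutelyContinuousOnInterval hT hu hb L b (x 0)))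
  obtain ⟨C, hC⟩ := hac.const_of_ae_hasDerivAt_zero (by
    have h2 := duhamel_hasDerivAt hT hu hb L b (x 0)
    rw [ae_restrict_iff' measurableSet_Icc] at hd h2
    filter_upwards [hd, h2] with s h1 h2 hs
    rw [uIcc_of_le hT] at hs
    have h3 := hasDerivAt_exp_smul_const (-L) s
    simp only [smul_neg] at h3
    simp only [neg_smul]
    refine (h3.clm_apply ((h1 hs).sub (h2 hs))).congr_deriv ?_
    simp only [mul_neg, neg_apply, ← hy, mul_apply_eq_comp]
    rw [add_sub_add_right_eq_sub, ← map_sub, Pi.sub_apply, neg_add_cancel])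
  have h0 := hC 0 left_mem_uIcc
  have h1 := hC t (by rwa [uIcc_of_le hT])
  simp only [hy, duhamel_zero, sub_self, map_zero] at h0
  rw [← h0] at h1
  have h2 := congrArg (NormedSpace.exp (t • L) : F →L[ℝ] F) h1
  rw [exp_smul_apply_exp_neg_smul_apply, map_zero] at h2
  exact sub_eq_zero.1 h2

theorem eq_exp_smul_apply (hT : 0 ≤ T) (L : F →L[ℝ] F)
    {x : ℝ → F} (hx : AbsolutelyContinuousOnInterval x 0 T)
    (hd : ∀ᵐ t ∂volume.restrict (Icc 0 T), HasDerivAt x (L (x t)) t)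
    {t : ℝ} (ht : t ∈ Icc 0 T) : x t = NormedSpace.exp (t • L) (x 0) := by
  have := eq_duhamel hT (u := fun _ => 0) aestronglyMeasurable_const
    (Filter.Eventually.of_forall fun _ => by simp) L 0 hx (by simpa using hd) ht
  simpa [duhamel] using this

end LinearODE

/-! ### Analyticity of exponentials and their level sets. -/

/-- A real analytic function that takes a value on a set of positive measure in a compact interval
is constant. -/
theorem eq_const_of_analytic_of_not_ae_ne {f : ℝ → ℝ} (hf : ∀ t, AnalyticAt ℝ f t) {a b c : ℝ}
    (h : ¬ ∀ᵐ t ∂volume.restrict (Icc a b), f t ≠ c) (t : ℝ) : f t = c := by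
  set S := {t ∈ Icc a b | f t = c} with hS
  -- Finite sets are null, so the level set is infinite and accumulates in the compact interval; the
  -- identity theorem then applies.
  have hinf : S.Infinite := by
    intro hfin
    apply h
    rw [ae_restrict_iff' measurableSet_Icc]
    have := (hfin.measure_zero (μ := volume))
    rw [measure_eq_zero_iff_ae_notMem] at this
    filter_upwards [this] with s hs hsI hsc using hs ⟨hsI, hsc⟩
  obtain ⟨z, -, hz⟩ := hinf.exists_accPt_of_subset_isCompact isCompact_Icc
    (fun s hs => hs.1 : S ⊆ Icc a b)
  rw [accPt_iff_frequently_nhdsNE] at hz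
  exact AnalyticOnNhd.eqOn_of_preconnected_of_frequently_eq (U := univ) (z₀ := z)
    (fun s _ => hf s) (fun s _ => analyticAt_const (v := c)) isPreconnected_univ (mem_univ _)
    (hz.mono fun s hs => hs.2) (mem_univ t)

section Exp

variable {𝔸 : Type*} [NormedRing 𝔸] [NormedAlgebra ℝ 𝔸] [CompleteSpace 𝔸]

theorem analyticAt_clm_exp_smul (a : 𝔸) (l : 𝔸 →L[ℝ] ℝ) (T t : ℝ) :
    AnalyticAt ℝ (fun s : ℝ => l (NormedSpace.exp ((T - s) • a))) t := by
  refine (l.analyticAt _).comp ?_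
  refine (NormedSpace.exp_analytic (𝕂 := ℝ) _).comp ?_
  fun_prop

/-- Each differentiation of `l(a^k exp(sa))` in `s` produces another factor `a`; evaluate at `s =
0`. The exponent zero is excluded because there the value is `c`. -/
theorem clm_pow_eq_zero_of_clm_exp_const (a : 𝔸) (l : 𝔸 →L[ℝ] ℝ) (c : ℝ)
    (h : ∀ s : ℝ, l (NormedSpace.exp (s • a)) = c) {m : ℕ} (hm : 1 ≤ m) : l (a ^ m) = 0 := by
  have step : ∀ (k : ℕ) (c : ℝ), (∀ s : ℝ, l (a ^ k * NormedSpace.exp (s • a)) = c) →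
      ∀ s : ℝ, l (a ^ (k + 1) * NormedSpace.exp (s • a)) = 0 := by
    intro k c hk s
    have h1 : HasDerivAt (fun s : ℝ => l (a ^ k * NormedSpace.exp (s • a)))
        (l (a ^ k * (a * NormedSpace.exp (s • a)))) s :=
      l.hasFDerivAt.comp_hasDerivAt s ((hasDerivAt_exp_smul_const' a s).const_mul (a ^ k))
    rw [funext hk] at h1
    rw [pow_succ, mul_assoc]
    exact h1.unique (hasDerivAt_const s c)
  have main : ∀ k : ℕ, ∀ s : ℝ, l (a ^ (k + 1) * NormedSpace.exp (s • a)) = 0 := by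
    intro k
    induction k with
    | zero => exact step 0 c (by simpa using h)
    | succ k ih => exact step (k + 1) 0 ih
  obtain ⟨k, rfl⟩ := Nat.exists_eq_add_of_le' hm
  simpa [NormedSpace.exp_zero] using main k 0

end Exp

/-! ### Uniform treatment of the parameter in a Banach algebra. -/

namespace Problem

variable {d ν : ℕ} (P : Problem d ν)

instance : CompactSpace P.Λ := isCompact_iff_compactSpace.mp P.Λ_compact

/-- The Banach algebra of continuous operator-valued functions on the uncertainty set. -/
def OpAlg : Type := BoundedContinuousFunction P.Λ (E d →L[ℝ] E d)

instance : NormedRing P.OpAlg :=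
  inferInstanceAs (NormedRing (BoundedContinuousFunction P.Λ (E d →L[ℝ] E d)))

instance : NormedAlgebra ℝ P.OpAlg :=
  inferInstanceAs (NormedAlgebra ℝ (BoundedContinuousFunction P.Λ (E d →L[ℝ] E d)))

instance : CompleteSpace P.OpAlg :=
  inferInstanceAs (CompleteSpace (BoundedContinuousFunction P.Λ (E d →L[ℝ] E d)))

variable {P} in
/-- Evaluation at a parameter as a ring homomorphism. -/
def evalRingHom (α : P.Λ) : P.OpAlg →+* (E d →L[ℝ] E d) where
  toFun M := BoundedContinuousFunction.toContinuousMap M α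
  map_one' := rfl
  map_zero' := rfl
  map_mul' _ _ := rfl
  map_add' _ _ := rfl

instance : FunLike P.OpAlg P.Λ (E d →L[ℝ] E d) where
  coe M α := evalRingHom α M
  coe_injective M N h := DFunLike.ext (F := BoundedContinuousFunction P.Λ (E d →L[ℝ] E d)) M N
    fun α => congrFun h α

theorem OpAlg.continuous (M : P.OpAlg) : Continuous fun α : P.Λ => M α :=
  (BoundedContinuousFunction.toContinuousMap M).continuous

theorem OpAlg.norm_apply_le (M : P.OpAlg) (α : P.Λ) : ‖M α‖ ≤ ‖M‖ :=
  BoundedContinuousFunction.norm_coe_le_norm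
    (show BoundedContinuousFunction P.Λ (E d →L[ℝ] E d) from M) α

theorem OpAlg.add_apply (M N : P.OpAlg) (α : P.Λ) : (M + N) α = M α + N α := rfl

theorem OpAlg.smul_apply (r : ℝ) (M : P.OpAlg) (α : P.Λ) : (r • M) α = r • M α := rfl

/-- The system matrices as an element of `OpAlg`. -/
def opMap : P.OpAlg := BoundedContinuousFunction.mkOfCompact
  { toFun := fun α => Matrix.toEuclideanCLM (𝕜 := ℝ) (P.A α)
    continuous_toFun := by
      obtain ⟨O, -, hO, hA, -⟩ := P.data_C1
      have h1 : Continuous (Matrix.toEuclideanCLM (n := Fin d) (𝕜 := ℝ)) :=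
        LinearMap.continuous_of_finiteDimensional
          (Matrix.toEuclideanCLM (n := Fin d) (𝕜 := ℝ)).toAlgEquiv.toLinearMap
      refine h1.comp (continuous_pi fun i => continuous_pi fun j => ?_)
      exact ((hA i j).continuousOn.mono hO).domRestrict }

/-- The input vectors as a continuous function on the uncertainty set. -/
def inputMap : C(P.Λ, E d) where
  toFun α := P.b α
  continuous_toFun := by
    obtain ⟨O, -, hO, -, hb⟩ := P.data_C1
    exact (hb.continuousOn.mono hO).domRestrict

theorem inputMap_apply (α : P.Λ) : P.inputMap α = P.b α := rfl

variable {P} in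
/-- Evaluation of an operator-valued function at a parameter. -/
def evalCLM (α : P.Λ) : P.OpAlg →L[ℝ] (E d →L[ℝ] E d) :=
  LinearMap.mkContinuous
    { toFun := fun M : P.OpAlg => M α
      map_add' := fun M N => map_add (evalRingHom α) M N
      map_smul' := fun r M => OpAlg.smul_apply P r M α } 1
    fun M => by rw [one_mul]; exact OpAlg.norm_apply_le P M α

theorem opMap_pow_apply (m : ℕ) (α : P.Λ) :
    (P.opMap ^ m) α = Matrix.toEuclideanCLM (𝕜 := ℝ) (P.A α ^ m) := by
  have := map_pow (evalRingHom α) P.opMap m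
  rw [map_pow]
  exact this

/-- Evaluation at `α` is a continuous ring homomorphism, so it passes through the exponential
series. Continuity in `α` of all the flows comes from this. -/
theorem exp_smul_opMap_apply (t : ℝ) (α : P.Λ) :
    NormedSpace.exp (t • P.opMap) α =
      NormedSpace.exp (t • Matrix.toEuclideanCLM (𝕜 := ℝ) (P.A α)) := by
  let +nondep : NormedAlgebra ℚ P.OpAlg := .restrictScalars ℚ ℝ _
  let +nondep : NormedAlgebra ℚ (E d →L[ℝ] E d) := .restrictScalars ℚ ℝ _
  exact NormedSpace.map_exp (evalRingHom α) (evalCLM α).continuous (t • P.opMap)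

/-- The accumulated control, transported back to the initial time. -/
def reach (u : ℝ → ℝ) (t : ℝ) : P.OpAlg :=
  ∫ s in (0 : ℝ)..t, u s • NormedSpace.exp ((-s) • P.opMap)

/-- The states at time `t` as a continuous function on the uncertainty set. -/
def stateMap (u : ℝ → ℝ) (t : ℝ) : C(P.Λ, E d) where
  toFun α := NormedSpace.exp (t • P.opMap) α (P.xi + P.reach u t α (P.b α))
  continuous_toFun := (OpAlg.continuous P _).clm_apply
    (continuous_const.add ((OpAlg.continuous P _).clm_apply (map_continuous P.inputMap)))

theorem stateMap_apply (u : ℝ → ℝ) (t : ℝ) (α : P.Λ) : P.stateMap u t α =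
    NormedSpace.exp (t • P.opMap) α (P.xi + P.reach u t α (P.b α)) := rfl

/-- An admissible control. -/
structure IsControl (u : ℝ → ℝ) : Prop where
  aestronglyMeasurable : AEStronglyMeasurable u P.timeMeasure
  mem : ∀ᵐ t ∂P.timeMeasure, u t ∈ Icc (-1 : ℝ) 1

variable {P} {u : ℝ → ℝ} {x : E ν → ℝ → E d}

theorem IsControlledPair.isControl (h : P.IsControlledPair u x) : P.IsControl u :=
  ⟨h.control_memLp.1, h.control_mem⟩

theorem IsControl.intervalIntegrable (h : P.IsControl u) {t : ℝ} (ht : t ∈ Icc 0 P.T) :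
    IntervalIntegrable (fun s => u s • NormedSpace.exp ((-s) • P.opMap)) volume 0 t := by
  refine (intervalIntegrable_smul_of_control P.T_pos.le h.1 h.2
    ((continuous_exp_smul P.opMap).comp continuous_neg)).mono_set ?_
  rw [uIcc_of_le ht.1, uIcc_of_le P.T_pos.le]
  exact Icc_subset_Icc_right ht.2

/-- Evaluation of an operator-valued function at a parameter and a vector. -/
def evalApply (α : P.Λ) (z : E d) : P.OpAlg →L[ℝ] E d :=
  (ContinuousLinearMap.apply ℝ (E d) z).comp (evalCLM α)

/-- Evaluation is continuous and linear, so it commutes with the Bochner integral that defines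
`reach`. -/
theorem duhamel_eq_stateMap (h : P.IsControl u) {t : ℝ} (ht : t ∈ Icc 0 P.T) (α : P.Λ) :
    duhamel (Matrix.toEuclideanCLM (𝕜 := ℝ) (P.A α)) u (P.b α) P.xi t = P.stateMap u t α := by
  have h1 := (evalApply α (P.b α)).intervalIntegral_comp_comm (h.intervalIntegrable ht)
  have h2 : P.reach u t α (P.b α) = evalApply α (P.b α) (P.reach u t) := rfl
  rw [stateMap_apply, h2, reach, ← h1, duhamel, exp_smul_opMap_apply]
  congr 2
  refine intervalIntegral.integral_congr fun s _ => ?_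
  have h3 : evalApply α (P.b α) (u s • NormedSpace.exp ((-s) • P.opMap)) =
    u s • NormedSpace.exp ((-s) • P.opMap) α (P.b α) := rfl
  simp only [h3, exp_smul_opMap_apply]

/-- A process is given separately for each `α`; uniqueness of solutions supplies the continuity of
its states in `α`. -/
theorem IsControlledPair.eq_stateMap (h : P.IsControlledPair u x) {t : ℝ} (ht : t ∈ Icc 0 P.T)
    (α : P.Λ) : x α t = P.stateMap u t α := by
  rw [← duhamel_eq_stateMap h.isControl ht, ← h.state_init α α.2]
  exact eq_duhamel P.T_pos.le h.isControl.1 h.isControl.2 _ _ (h.state_ac α α.2)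
    (h.state_ode α α.2) ht

theorem IsControl.isControlledPair (h : P.IsControl u) : P.IsControlledPair u
    fun α => duhamel (Matrix.toEuclideanCLM (𝕜 := ℝ) (P.A α)) u (P.b α) P.xi where
  control_memLp := memLp_top_of_bound h.1 1 <| by
    filter_upwards [h.2] with t ht
    rw [Real.norm_eq_abs, abs_le]; exact ht
  control_mem := h.2
  state_ac α _ := duhamel_absolutelyContinuousOnInterval P.T_pos.le h.1 h.2 _ _ _
  state_init α _ := duhamel_zero _ _ _ _
  state_ode α _ := duhamel_hasDerivAt P.T_pos.le h.1 h.2 _ _ _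

theorem integrable_inner_continuous {κ : Measure P.Λ} {q : P.Λ → E d} (hq : Integrable q κ)
    {c : P.Λ → E d} (hc : Continuous c) : Integrable (fun α => inner ℝ (q α) (c α)) κ := by
  obtain ⟨C, hC⟩ := (isCompact_univ (X := P.Λ)).exists_bound_of_continuousOn hc.continuousOn
  refine (hq.norm.mul_const C).mono (hq.1.inner hc.aestronglyMeasurable)
    (Filter.Eventually.of_forall fun α => ?_)
  rw [Real.norm_eq_abs]
  refine (abs_real_inner_le_norm _ _).trans ?_
  have h0 : 0 ≤ C := (norm_nonneg _).trans (hC α (mem_univ _))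
  rw [Real.norm_of_nonneg (by positivity)]
  exact mul_le_mul_of_nonneg_left (hC α (mem_univ _)) (norm_nonneg _)

theorem continuous_opAlg_apply (M : P.OpAlg) (c : C(P.Λ, E d)) :
    Continuous fun α => M α (c α) :=
  (OpAlg.continuous P M).clm_apply c.continuous

/-- Integration of `⟪q α, M α (c α)⟫` against a measure on the uncertainty set, as a continuous
linear functional of the operator-valued function `M`. -/
def pairing {κ : Measure P.Λ} {q : P.Λ → E d} (hq : Integrable q κ) (c : C(P.Λ, E d)) :
    P.OpAlg →L[ℝ] ℝ :=
  LinearMap.mkContinuous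
    { toFun := fun M : P.OpAlg => ∫ α, inner ℝ (q α) (M α (c α)) ∂κ
      map_add' := fun M N => by
        rw [← integral_add (integrable_inner_continuous hq (continuous_opAlg_apply M c))
          (integrable_inner_continuous hq (continuous_opAlg_apply N c))]
        simp [OpAlg.add_apply P M, inner_add_right]
      map_smul' := fun r M => by
        simp [OpAlg.smul_apply P r M, inner_smul_right, integral_const_mul] }
    (‖c‖ * ∫ α, ‖q α‖ ∂κ) fun M => by
      refine (norm_integral_le_of_norm_le ((hq.norm.mul_const (‖M‖ * ‖c‖)))
        (Filter.Eventually.of_forall fun α => ?_)).trans_eq ?_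
      · rw [Real.norm_eq_abs]
        refine (abs_real_inner_le_norm _ _).trans ?_
        refine mul_le_mul_of_nonneg_left ?_ (norm_nonneg _)
        refine ((M α).le_opNorm _).trans ?_
        exact mul_le_mul (OpAlg.norm_apply_le P M α) (c.norm_coe_le_norm α) (norm_nonneg _)
          (norm_nonneg _)
      · rw [integral_mul_const]; ring

theorem pairing_apply {κ : Measure P.Λ} {q : P.Λ → E d} (hq : Integrable q κ) (c : C(P.Λ, E d))
    (M : P.OpAlg) : pairing hq c M = ∫ α, inner ℝ (q α) (M α (c α)) ∂κ := rfl

end Problem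

/-! ### Switching function and bang-off-bang structure. -/

/-- On the segment from `x` to `y` a convex function has secant slope at least its initial
derivative. -/
theorem inner_gradient_le_sub {F : Type*} [NormedAddCommGroup F] [InnerProductSpace ℝ F]
    [CompleteSpace F] {ψ : F → ℝ} (hc : ConvexOn ℝ univ ψ) {x : F} (hd : DifferentiableAt ℝ ψ x)
    (y : F) : inner ℝ (gradient ψ x) (y - x) ≤ ψ y - ψ x := by
  have hg : ConvexOn ℝ univ (ψ ∘ (AffineMap.lineMap x y : ℝ →ᵃ[ℝ] F)) := by
    simpa using hc.comp_affineMap (AffineMap.lineMap x y : ℝ →ᵃ[ℝ] F)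
  have hl : HasDerivAt (AffineMap.lineMap x y : ℝ → F) (y - x) 0 := AffineMap.hasDerivAt_lineMap
  have hψ : HasFDerivAt ψ (InnerProductSpace.toDual ℝ F (gradient ψ x))
      ((AffineMap.lineMap x y : ℝ → F) 0) := by
    rw [AffineMap.lineMap_apply_zero]
    exact hd.hasGradientAt.hasFDerivAt
  have h := hg.le_slope_of_hasDerivAt (mem_univ (0 : ℝ)) (mem_univ (1 : ℝ)) one_pos
    (hψ.comp_hasDerivAt 0 hl)
  simpa [slope_def_field] using h

theorem exp_neg_star_eq {d : ℕ} (A : Matrix (Fin d) (Fin d) ℝ) (t : ℝ) :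
    NormedSpace.exp (t • (-(Matrix.toEuclideanCLM (𝕜 := ℝ) A.transpose))) =
      ContinuousLinearMap.adjoint (NormedSpace.exp ((-t) • Matrix.toEuclideanCLM (𝕜 := ℝ) A)) := by
  have h1 : Matrix.toEuclideanCLM (𝕜 := ℝ) A.transpose =
      star (Matrix.toEuclideanCLM (𝕜 := ℝ) A) := by
    rw [← map_star, Matrix.star_eq_conjTranspose, Matrix.conjTranspose_eq_transpose_of_trivial]
  rw [← ContinuousLinearMap.star_eq_adjoint, NormedSpace.star_exp, h1]
  simp

namespace Problem

variable {d ν : ℕ} {P : Problem d ν} {u : ℝ → ℝ} {x : E ν → ℝ → E d} {η : ℝ}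
  {lam : Measure (E ν)} {p : E ν → ℝ → E d}

variable (P) in
/-- A family of solutions of the adjoint equation with integrable terminal values. -/
structure IsCostate (lam : Measure (E ν)) (p : E ν → ℝ → E d) : Prop where
  ac : ∀ᵐ α ∂lam, AbsolutelyContinuousOnInterval (p α) 0 P.T
  integrable : Integrable (fun α => p α P.T) lam
  adjoint : ∀ᵐ α ∂lam, ∀ᵐ t ∂P.timeMeasure,
    HasDerivAt (p α) (-(Matrix.toEuclideanCLM (𝕜 := ℝ) (P.A α).transpose (p α t))) t

theorem IsMultiplier.isCostate (h : P.IsMultiplier u x η lam p) : P.IsCostate lam p :=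
  ⟨h.costate_ac, h.costate_integrable, h.adjoint⟩

/-- The adjoint flow is the adjoint of the inverse state flow; eliminating `p(0;α)` moves it onto
`z`. One null set of parameters serves all `t` and `z`. -/
theorem IsCostate.inner_costate (h : P.IsCostate lam p) :
    ∀ᵐ α ∂lam, ∀ t ∈ Icc 0 P.T, ∀ z : E d, inner ℝ (p α t) z =
      inner ℝ (p α P.T)
        (NormedSpace.exp ((P.T - t) • Matrix.toEuclideanCLM (𝕜 := ℝ) (P.A α)) z) := by
  filter_upwards [h.ac, h.adjoint] with α h1 h2 t ht z
  have key : ∀ s ∈ Icc 0 P.T, p α s = ContinuousLinearMap.adjoint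
      (NormedSpace.exp ((-s) • Matrix.toEuclideanCLM (𝕜 := ℝ) (P.A α))) (p α 0) := by
    intro s hs
    rw [← exp_neg_star_eq]
    exact eq_exp_smul_apply P.T_pos.le _ h1 h2 hs
  rw [key t ht, key P.T ⟨P.T_pos.le, le_rfl⟩, ContinuousLinearMap.adjoint_inner_left,
    ContinuousLinearMap.adjoint_inner_left]
  congr 1
  let +nondep : NormedAlgebra ℚ (E d →L[ℝ] E d) := .restrictScalars ℚ ℝ _
  rw [← mul_apply_eq_comp, ← NormedSpace.exp_add_of_commute, ← add_smul]
  · congr 3; ring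
  · exact ((Commute.refl _).smul_left _).smul_right _

theorem map_comap_val (P : Problem d ν) (lam : Measure (E ν)) :
    Measure.map (Subtype.val : P.Λ → E ν) (Measure.comap (Subtype.val : P.Λ → E ν) lam) =
      lam.restrict P.Λ :=
  map_comap_subtype_coe P.Λ_compact.measurableSet lam

theorem ae_comap_of_ae {Q : E ν → Prop} (h : ∀ᵐ α ∂lam, Q α) :
    ∀ᵐ α : P.Λ ∂(Measure.comap (Subtype.val : P.Λ → E ν) lam), Q α := by
  have h1 := ae_restrict_of_ae (s := P.Λ) h
  rw [← map_comap_val] at h1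
  exact ae_of_ae_map measurable_subtype_coe.aemeasurable h1

theorem integrable_comap {q : E ν → E d} (h : Integrable q lam) :
    Integrable (fun α : P.Λ => q α) (Measure.comap (Subtype.val : P.Λ → E ν) lam) := by
  have h1 := h.restrict (s := P.Λ)
  rw [← map_comap_val] at h1
  exact h1.comp_measurable measurable_subtype_coe

/-- The switching function in terms of the terminal costate. -/
theorem IsCostate.switching_eq (h : P.IsCostate lam p) {t : ℝ} (ht : t ∈ Icc 0 P.T) :
    P.switching lam p t = pairing (integrable_comap (P := P) h.integrable) P.inputMap
      (NormedSpace.exp ((P.T - t) • P.opMap)) := by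
  rw [pairing_apply, switching, ← integral_subtype_comap P.Λ_compact.measurableSet]
  refine integral_congr_ae ?_
  filter_upwards [ae_comap_of_ae h.inner_costate] with α hα
  rw [hα t ht, exp_smul_opMap_apply, inputMap_apply]

theorem IsMultiplier.ae_mem_activeSet (h : P.IsMultiplier u x η lam p) :
    ∀ᵐ α ∂lam, α ∈ P.activeSet x :=
  Filter.mem_of_superset Measure.support_mem_ae h.support

/-- If `μ > 0` then `ψ` vanishes at the terminal state, so the gradient inequality bounds `⟪∇ψ, y -
x⟫` by `ψ y ≤ 0`. -/
theorem IsMultiplier.neg_costate_mem_normalCone (h : P.IsMultiplier u x η lam p) :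
    ∀ᵐ α ∂lam, -(p α P.T) ∈ normalCone P.target (x α P.T) := by
  filter_upwards [h.transversality] with α ⟨μ, hμ, h1, h2⟩ y hy
  rw [h1, real_inner_smul_left]
  rcases hμ.eq_or_lt with rfl | hμ'
  · simp
  · have h3 := inner_gradient_le_sub P.ψ_convex
      ((P.ψ_C1.differentiable one_ne_zero) (x α P.T)) y
    rw [h2 hμ'] at h3
    have h4 : P.ψ y ≤ 0 := hy
    exact mul_nonpos_of_nonneg_of_nonpos hμ (by linarith)

/-- Under the averaged controllability condition a level set `|φ| = η` is negligible. -/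
theorem IsMultiplier.ae_abs_switching_ne (h : P.IsMultiplier u x η lam p) (hη : 0 < η)
    (hc : P.AveragedControllability x lam) :
    ∀ᵐ t ∂P.timeMeasure, |P.switching lam p t| ≠ η := by
  have hq := integrable_comap (P := P) h.costate_integrable
  set l := pairing hq P.inputMap with hl
  have hrestr : lam.restrict (P.activeSet x) = lam :=
    Measure.restrict_eq_self_of_ae_mem h.ae_mem_activeSet
  -- The levels `η` and `-η` are treated separately, since `φ` is analytic and `|φ|` need not be.
  have key : ∀ c : ℝ, c ≠ 0 →
      ∀ᵐ t ∂P.timeMeasure, l (NormedSpace.exp ((P.T - t) • P.opMap)) ≠ c := by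
    intro c hc0
    by_contra hne
    have hconst : ∀ s : ℝ, l (NormedSpace.exp (s • P.opMap)) = c := fun s => by
      simpa using eq_const_of_analytic_of_not_ae_ne (analyticAt_clm_exp_smul P.opMap l P.T) hne
        (P.T - s)
    -- The controllability condition asks for a measurable selection that is normal at every active
    -- parameter. A measurable representative of `-p(T;·)` is set to zero on a null set; zero lies
    -- in every normal cone.
    set g := h.costate_integrable.1.mk (fun α => p α P.T) with hg
    have hgm : Measurable g := h.costate_integrable.1.stronglyMeasurable_mk.measurable
    have hgp : ∀ᵐ α ∂lam, p α P.T = g α := h.costate_integrable.1.ae_eq_mk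
    obtain ⟨S, hS, hSm, hS0⟩ := exists_measurable_superset_of_null
      (ae_iff.1 (hgp.and h.neg_costate_mem_normalCone))
    set v : E ν → E d := Sᶜ.indicator fun α => -(g α) with hv
    have hvp : ∀ᵐ α ∂lam, v α = -(p α P.T) := by
      filter_upwards [hgp, measure_eq_zero_iff_ae_notMem.1 hS0] with α h1 h2
      rw [hv, indicator_of_mem (show α ∈ Sᶜ from h2), h1]
    have hvm : Measurable v := hgm.neg.indicator hSm.compl
    have hvi : Integrable v (lam.restrict (P.activeSet x)) := by
      rw [hrestr]
      exact h.costate_integrable.neg.congr (hvp.mono fun α hα => hα.symm)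
    have hvN : ∀ α ∈ P.activeSet x, v α ∈ normalCone P.target (x α P.T) := by
      intro α _
      by_cases hα : α ∈ S
      · rw [hv, indicator_of_notMem (by simpa using hα)]
        intro y _
        simp
      · rw [hv, indicator_of_mem (show α ∈ Sᶜ from hα)]
        have h1 : p α P.T = g α ∧ -(p α P.T) ∈ normalCone P.target (x α P.T) := by
          by_contra h2
          exact hα (hS h2)
        rw [← h1.1]
        exact h1.2
    have hp0 : ∀ᵐ α ∂lam, p α P.T = 0 := by
      by_contra hnz
      obtain ⟨m, hm1, -, hm⟩ := hc v hvm hvi hvN (by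
        rw [hrestr]
        intro h0
        apply hnz
        filter_upwards [h0, hvp] with α h1 h2
        rw [h1] at h2
        simpa using h2.symm)
      apply hm
      have h1 := clm_pow_eq_zero_of_clm_exp_const P.opMap l c hconst hm1
      rw [hl, pairing_apply] at h1
      have h2 : ∀ α : P.Λ, inner ℝ (p α P.T) ((P.opMap ^ m) α (P.inputMap α)) =
          (fun α : E ν => inner ℝ (p α P.T)
            (Matrix.toEuclideanCLM (𝕜 := ℝ) (P.A α ^ m) (P.b α))) α := fun α => by
        rw [opMap_pow_apply, inputMap_apply]
      simp_rw [h2] at h1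
      rw [integral_subtype_comap P.Λ_compact.measurableSet (fun α : E ν => inner ℝ (p α P.T)
            (Matrix.toEuclideanCLM (𝕜 := ℝ) (P.A α ^ m) (P.b α))),
        Measure.restrict_eq_self_of_ae_mem (h.null_compl)] at h1
      rw [hrestr, ← neg_eq_zero, ← integral_neg, ← h1]
      refine integral_congr_ae ?_
      filter_upwards [hvp] with α hα
      rw [hα, inner_neg_right, neg_neg, real_inner_comm]
    apply hc0
    rw [← hconst 0, hl, pairing_apply]
    refine integral_eq_zero_of_ae ?_
    filter_upwards [ae_comap_of_ae hp0] with α hα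
    simp [hα]
  filter_upwards [key η hη.ne', key (-η) (neg_ne_zero.2 hη.ne'),
    ae_restrict_mem measurableSet_Icc] with t h1 h2 ht habs
  rw [h.isCostate.switching_eq ht] at habs
  rcases eq_or_eq_neg_of_abs_eq habs with h3 | h3
  · exact h1 h3
  · exact h2 h3

/-- The averaged Hamiltonian is affine in the control, with slope the switching function. -/
theorem IsCostate.exists_hamiltonian_eq (h : P.IsCostate lam p) (hx : P.IsControlledPair u x)
    {t : ℝ} (ht : t ∈ Icc 0 P.T) : ∃ K : ℝ, ∀ w : ℝ, (∫ α in P.Λ, inner ℝ (p α t)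
      (Matrix.toEuclideanCLM (𝕜 := ℝ) (P.A α) (x α t) + w • P.b α) ∂lam) =
        K + P.switching lam p t * w := by
  set κ := Measure.comap (Subtype.val : P.Λ → E ν) lam with hκ
  have hq := integrable_comap (P := P) h.integrable
  have hae := ae_comap_of_ae (P := P) h.inner_costate
  have hint : ∀ {c : P.Λ → E d}, Continuous c →
      Integrable (fun α : P.Λ => inner ℝ (p α t) (c α)) κ := by
    intro c hc
    refine (integrable_inner_continuous hq
      ((OpAlg.continuous P (NormedSpace.exp ((P.T - t) • P.opMap))).clm_apply hc)).congr ?_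
    filter_upwards [hae] with α hα
    rw [hα t ht, exp_smul_opMap_apply]
  -- Integrability is what allows the Hamiltonian to be split; it follows from continuity of the
  -- state in `α`.
  have hA : Integrable (fun α : P.Λ => inner ℝ (p α t)
      (Matrix.toEuclideanCLM (𝕜 := ℝ) (P.A α) (x α t))) κ := by
    refine (hint (continuous_opAlg_apply P.opMap (P.stateMap u t))).congr
      (Filter.Eventually.of_forall fun α => ?_)
    simp only [hx.eq_stateMap ht α]
    rfl
  have hb : Integrable (fun α : P.Λ => inner ℝ (p α t) (P.b α)) κ := hint P.inputMap.continuous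
  refine ⟨∫ α : P.Λ, inner ℝ (p α t) (Matrix.toEuclideanCLM (𝕜 := ℝ) (P.A α) (x α t)) ∂κ,
    fun w => ?_⟩
  rw [switching, ← integral_subtype_comap P.Λ_compact.measurableSet,
    ← integral_subtype_comap P.Λ_compact.measurableSet, ← integral_mul_const, ← hκ,
    ← integral_add hA (hb.mul_const w)]
  simp only [inner_add_right, real_inner_smul_right, mul_comm w]

/-- The maximization condition in terms of the switching function. -/
theorem IsMultiplier.switching_le (h : P.IsMultiplier u x η lam p) (hx : P.IsControlledPair u x) :
    ∀ᵐ t ∂P.timeMeasure, u t ∈ Icc (-1 : ℝ) 1 ∧ ∀ v ∈ Icc (-1 : ℝ) 1,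
      P.switching lam p t * v - η * |v| ≤ P.switching lam p t * u t - η * |u t| := by
  filter_upwards [h.maximization, ae_restrict_mem measurableSet_Icc] with t ⟨hu, hmax⟩ ht
  refine ⟨hu, fun v hv => ?_⟩
  obtain ⟨K, hK⟩ := h.isCostate.exists_hamiltonian_eq hx ht
  have := hmax hv
  simp only [mem_ofPred_eq, hK] at this
  linarith

/-- Testing the maximum at `v = 1, 0, -1` suffices: for `φ > η`, `v = 1` gives `φ - η ≤ (φ - η) u`,
so `u ≥ 1`; the other cases are similar. -/
theorem IsMultiplier.bang_off_bang (h : P.IsMultiplier u x η lam p) (hx : P.IsControlledPair u x)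
    (hη : 0 < η) (hc : P.AveragedControllability x lam) :
    ∀ᵐ t ∂P.timeMeasure,
        |P.switching lam p t| ≠ η ∧
        (η < P.switching lam p t → u t = 1) ∧
        (|P.switching lam p t| < η → u t = 0) ∧
        (P.switching lam p t < -η → u t = -1) := by
  filter_upwards [h.ae_abs_switching_ne hη hc, h.switching_le hx] with t h1 ⟨⟨hl, hr⟩, h2⟩
  generalize P.switching lam p t = φ at *
  have hle := le_abs_self (u t)
  have hle' := neg_abs_le (u t)
  have habs : |u t| ≤ 1 := abs_le.2 ⟨hl, hr⟩
  have h0 := abs_nonneg (u t)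
  refine ⟨h1, fun hφ => ?_, fun hφ => ?_, fun hφ => ?_⟩
  · have h3 := h2 1 (by norm_num)
    rw [abs_one] at h3
    nlinarith
  · have h3 := h2 0 (by norm_num)
    rw [abs_zero, mul_zero, mul_zero, sub_zero] at h3
    have h4 : φ * u t ≤ |φ| * |u t| := by rw [← abs_mul]; exact le_abs_self _
    rw [← abs_eq_zero]
    nlinarith
  · have h3 := h2 (-1) (by norm_num)
    rw [abs_neg, abs_one] at h3
    nlinarith

end Problem

/-! ### Fritz John multipliers by separation. -/

section FritzJohn

open CompactlySupported

variable {X : Type*} [TopologicalSpace X] [CompactSpace X] [T2Space X] [MeasurableSpace X]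
  [BorelSpace X]

/-- Riesz representation of positive functionals on `C(X, ℝ)` for compact `X`. -/
theorem exists_measure_of_positive (l : C(X, ℝ) →ₗ[ℝ] ℝ) (hl : ∀ g : C(X, ℝ), 0 ≤ g → 0 ≤ l g) :
    ∃ κ : Measure X, IsFiniteMeasure κ ∧ ∀ g : C(X, ℝ), ∫ α, g α ∂κ = l g := by
  let L : C_c(X, ℝ) →ₚ[ℝ] ℝ :=
  { toFun g := l g.toContinuousMap
    map_add' g g' := map_add l g.toContinuousMap g'.toContinuousMap
    map_smul' c g := map_smul l c g.toContinuousMap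
    monotone' g g' hgg' := by
      have h := hl (g'.toContinuousMap - g.toContinuousMap) (sub_nonneg.2 hgg')
      rw [map_sub] at h
      exact sub_nonneg.1 h }
  refine ⟨RealRMK.rieszMeasure L, inferInstance, fun g => ?_⟩
  exact RealRMK.integral_rieszMeasure L
    { toContinuousMap := g
      hasCompactSupport' := HasCompactSupport.of_compactSpace _ }

/-- The Fritz John rule for a convex optimization problem with a continuum of inequality
constraints indexed by a compact space. -/
theorem exists_fritzJohn_multiplier {U : Type*} {adm : U → Prop} {J : U → ℝ} {G : U → C(X, ℝ)}
    {J₀ : ℝ} (hne : ∃ u, adm u)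
    (hconv : ∀ u w, adm u → adm w → ∀ a b : ℝ, 0 ≤ a → 0 ≤ b → a + b = 1 →
      ∃ v, adm v ∧ J v ≤ a * J u + b * J w ∧ ∀ α, G v α ≤ a * G u α + b * G w α)
    (hmin : ∀ u, adm u → J u < J₀ → ¬ ∀ α, G u α < 0) :
    ∃ (η : ℝ) (κ : Measure X), 0 ≤ η ∧ IsFiniteMeasure κ ∧ η + κ.real univ = 1 ∧
      ∀ u, adm u → 0 ≤ η * (J u - J₀) + ∫ α, G u α ∂κ := by
  -- Strict upper bounds of the attainable pairs. Strictness and compactness of `X` make this set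
  -- open although `U` has no topology, and optimality keeps the origin out.
  set S : Set (ℝ × C(X, ℝ)) := {q | ∃ u, adm u ∧ J u - J₀ < q.1 ∧ ∀ α, G u α < q.2 α} with hS
  have hSconv : Convex ℝ S := by
    rintro ⟨r, g⟩ ⟨u, hu, hur, hug⟩ ⟨r', g'⟩ ⟨w, hw, hwr, hwg⟩ a b ha hb hab
    obtain ⟨v, hv, hJ, hG⟩ := hconv u w hu hw a b ha hb hab
    have key : ∀ {s s' t t' : ℝ}, s < t → s' < t' → a * s + b * s' < a * t + b * t' := by
      intro s s' t t' h h'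
      rcases ha.eq_or_lt with rfl | ha'
      · have : b = 1 := by linarith
        subst this; linarith
      · have h1 := mul_lt_mul_of_pos_left h ha'
        have h2 := mul_le_mul_of_nonneg_left h'.le hb
        linarith
    refine ⟨v, hv, ?_, fun α => ?_⟩
    · have h1 := key hur hwr
      simp only [Prod.smul_mk, Prod.mk_add_mk, smul_eq_mul]
      have h2 : a * J₀ + b * J₀ = J₀ := by rw [← add_mul, hab, one_mul]
      nlinarith
    · simpa using (hG α).trans_lt (key (hug α) (hwg α))
  have hSopen : IsOpen S := by
    have hSU : S = ⋃ u, ⋃ _ : adm u, {q : ℝ × C(X, ℝ) | J u - J₀ < q.1} ∩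
        (fun q : ℝ × C(X, ℝ) => q.2 - G u) ⁻¹' {g : C(X, ℝ) | MapsTo g univ (Ioi 0)} := by
      ext q
      simp [hS, MapsTo, and_left_comm]
    rw [hSU]
    refine isOpen_iUnion fun u => isOpen_iUnion fun _ => IsOpen.inter ?_ ?_
    · exact isOpen_lt continuous_const continuous_fst
    · exact (ContinuousMap.isOpen_setOfPred_mapsTo isCompact_univ isOpen_Ioi).preimage
        (continuous_snd.sub continuous_const)
  have h0 : (0 : ℝ × C(X, ℝ)) ∉ S := by
    rintro ⟨u, hu, h1, h2⟩
    exact hmin u hu (by simpa using h1) h2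
  obtain ⟨f, hf⟩ := geometric_hahn_banach_point_open hSconv hSopen h0
  rw [map_zero] at hf
  obtain ⟨u₀, hu₀⟩ := hne
  have hmem : ∀ u, adm u → ∀ ε : ℝ, 0 < ε →
      ((J u - J₀ + ε, G u + ContinuousMap.const X ε) : ℝ × C(X, ℝ)) ∈ S := fun u hu ε hε =>
    ⟨u, hu, by simpa using hε, fun α => by simpa using hε⟩
  have hup : ∀ q ∈ S, ∀ r : ℝ × C(X, ℝ), 0 ≤ r → q + r ∈ S := by
    rintro q ⟨u, hu, h1, h2⟩ r hr
    exact ⟨u, hu, h1.trans_le (le_add_of_nonneg_right hr.1),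
      fun α => (h2 α).trans_le (le_add_of_nonneg_right (hr.2 α))⟩
  -- The set is closed under adding nonnegative elements; a negative value of `f` would become
  -- unbounded along multiples of `r`.
  have hpos : ∀ r : ℝ × C(X, ℝ), 0 ≤ r → 0 ≤ f r := by
    intro r hr
    by_contra hneg
    push Not at hneg
    obtain ⟨n, hn⟩ := exists_nat_gt (f (J u₀ - J₀ + 1, G u₀ + ContinuousMap.const X 1) / (-f r))
    have h1 := hf _ (hup _ (hmem u₀ hu₀ 1 one_pos) ((n : ℝ) • r) (smul_nonneg n.cast_nonneg hr))
    rw [map_add, map_smul, smul_eq_mul] at h1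
    rw [div_lt_iff₀ (by linarith)] at hn
    linarith
  set η := f (1, 0) with hη
  have hη0 : 0 ≤ η := hpos _ ⟨zero_le_one, le_rfl⟩
  obtain ⟨κ, hκ, hκl⟩ := exists_measure_of_positive
    ((f : ℝ × C(X, ℝ) →ₗ[ℝ] ℝ).comp (LinearMap.inr ℝ ℝ C(X, ℝ)))
    (fun g hg => hpos _ ⟨le_rfl, hg⟩)
  have hfe : ∀ (r : ℝ) (g : C(X, ℝ)), f (r, g) = η * r + ∫ α, g α ∂κ := by
    intro r g
    rw [hκl g]
    have h1 : ((r, g) : ℝ × C(X, ℝ)) = r • ((1, 0) : ℝ × C(X, ℝ)) + (0, g) := by simp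
    rw [h1, map_add, map_smul, smul_eq_mul, mul_comm]
    rfl
  have hineq : ∀ u, adm u → ∀ ε : ℝ, 0 < ε →
      0 < η * (J u - J₀) + ∫ α, G u α ∂κ + ε * (η + κ.real univ) := by
    intro u hu ε hε
    have h1 := hf _ (hmem u hu ε hε)
    rw [hfe] at h1
    have h2 : ∫ α, (G u + ContinuousMap.const X ε) α ∂κ = ∫ α, G u α ∂κ + ε * κ.real univ := by
      simp only [ContinuousMap.add_apply, ContinuousMap.const_apply]
      rw [integral_add ((map_continuous (G u)).integrable_of_hasCompactSupport
        (HasCompactSupport.of_compactSpace _))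
        (integrable_const ε), integral_const, smul_eq_mul, mul_comm]
    rw [h2] at h1
    linarith
  set K := η + κ.real univ with hK
  have hK0 : 0 ≤ K := add_nonneg hη0 measureReal_nonneg
  have hnonneg : ∀ u, adm u → 0 ≤ η * (J u - J₀) + ∫ α, G u α ∂κ := by
    intro u hu
    refine le_of_forall_pos_le_add fun ε hε => ?_
    have h1 := hineq u hu (ε / (K + 1)) (by positivity)
    have h2 : ε / (K + 1) * K ≤ ε := by
      rw [div_mul_eq_mul_div, div_le_iff₀ (by positivity)]
      nlinarith
    linarith
  -- If the total mass were zero, the separating functional would vanish, against strict separation.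
  -- This permits normalization.
  have hKpos : 0 < K := by
    refine hK0.lt_of_ne fun h => ?_
    have hη' : η = 0 := by
      have : 0 ≤ κ.real univ := measureReal_nonneg
      linarith
    have hκ' : κ = 0 := by
      have : κ.real univ = 0 := by linarith
      rwa [measureReal_def, ENNReal.toReal_eq_zero_iff, or_iff_left (measure_ne_top κ _),
        Measure.measure_univ_eq_zero] at this
    have h1 := hineq u₀ hu₀ 1 one_pos
    rw [← h, hη', hκ'] at h1
    simp at h1
  refine ⟨η / K, (ENNReal.ofReal K⁻¹) • κ, by positivity, ?_, ?_, fun u hu => ?_⟩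
  · exact Measure.smul_finite κ ENNReal.ofReal_ne_top
  · rw [measureReal_ennreal_smul_apply, ENNReal.toReal_ofReal (by positivity)]
    field_simp
    exact hK.symm
  · rw [integral_smul_measure, ENNReal.toReal_ofReal (by positivity), smul_eq_mul]
    have h1 := hnonneg u hu
    have h2 : η / K * (J u - J₀) + K⁻¹ * ∫ α, G u α ∂κ =
        K⁻¹ * (η * (J u - J₀) + ∫ α, G u α ∂κ) := by field_simp
    rw [h2]
    positivity

end FritzJohn

/-! ### Existence of multiplier triples. -/

namespace Problem

variable {d ν : ℕ} {P : Problem d ν} {u w : ℝ → ℝ} {x : E ν → ℝ → E d}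

theorem right_mem (P : Problem d ν) : P.T ∈ Icc 0 P.T := ⟨P.T_pos.le, le_rfl⟩

theorem IsControl.mix (hu : P.IsControl u) (hw : P.IsControl w) {a b : ℝ} (ha : 0 ≤ a)
    (hb : 0 ≤ b) (hab : a + b = 1) : P.IsControl fun t => a * u t + b * w t := by
  refine ⟨(hu.1.const_mul a).add (hw.1.const_mul b), ?_⟩
  filter_upwards [hu.2, hw.2] with t h1 h2
  exact convex_Icc (-1 : ℝ) 1 h1 h2 ha hb hab

theorem IsControl.integrable (hu : P.IsControl u) : IntervalIntegrable u volume 0 P.T := by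
  simpa using intervalIntegrable_smul_of_control P.T_pos.le hu.1 hu.2
    (continuous_const (y := (1 : ℝ)))

theorem cost_mix_le (hu : P.IsControl u) (hw : P.IsControl w) {a b : ℝ} (ha : 0 ≤ a)
    (hb : 0 ≤ b) (hab : a + b = 1) :
    P.cost (fun t => a * u t + b * w t) ≤ a * P.cost u + b * P.cost w := by
  have h1 := hu.integrable.abs
  have h2 := hw.integrable.abs
  simp only [cost]
  rw [← intervalIntegral.integral_const_mul, ← intervalIntegral.integral_const_mul,
    ← intervalIntegral.integral_add (h1.const_mul a) (h2.const_mul b)]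
  refine intervalIntegral.integral_mono P.T_pos.le (hu.mix hw ha hb hab).integrable.abs
    ((h1.const_mul a).add (h2.const_mul b)) fun t => ?_
  refine (abs_add_le _ _).trans_eq ?_
  rw [abs_mul, abs_mul, abs_of_nonneg ha, abs_of_nonneg hb]

theorem reach_mix (hu : P.IsControl u) (hw : P.IsControl w) (a b : ℝ) :
    P.reach (fun t => a * u t + b * w t) P.T = a • P.reach u P.T + b • P.reach w P.T := by
  have h1 := hu.intervalIntegrable P.right_mem
  have h2 := hw.intervalIntegrable P.right_mem
  have h3 := intervalIntegral.integral_add (h1.smul a) (h2.smul b)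
  simp only [Pi.smul_apply] at h3
  rw [reach, reach, reach, ← intervalIntegral.integral_smul, ← intervalIntegral.integral_smul, ← h3]
  simp only [add_smul, mul_smul]

theorem stateMap_mix (hu : P.IsControl u) (hw : P.IsControl w) {a b : ℝ} (hab : a + b = 1)
    (α : P.Λ) : P.stateMap (fun t => a * u t + b * w t) P.T α =
      a • P.stateMap u P.T α + b • P.stateMap w P.T α := by
  simp only [stateMap_apply, reach_mix hu hw, OpAlg.add_apply, OpAlg.smul_apply, add_apply,
    smul_apply, map_add, map_smul, smul_add]
  have h : NormedSpace.exp (P.T • P.opMap) α P.xi = a • NormedSpace.exp (P.T • P.opMap) α P.xi +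
      b • NormedSpace.exp (P.T • P.opMap) α P.xi := by rw [← add_smul, hab, one_smul]
  nth_rewrite 1 [h]
  abel

variable (P) in
/-- The terminal constraint function of a control. -/
def constraintMap (u : ℝ → ℝ) : C(P.Λ, ℝ) where
  toFun α := P.ψ (P.stateMap u P.T α)
  continuous_toFun := P.ψ_C1.continuous.comp (map_continuous _)

theorem constraintMap_apply (u : ℝ → ℝ) (α : P.Λ) :
    P.constraintMap u α = P.ψ (P.stateMap u P.T α) := rfl

theorem constraintMap_mix_le (hu : P.IsControl u) (hw : P.IsControl w) {a b : ℝ} (ha : 0 ≤ a)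
    (hb : 0 ≤ b) (hab : a + b = 1) (α : P.Λ) :
    P.constraintMap (fun t => a * u t + b * w t) α ≤
      a * P.constraintMap u α + b * P.constraintMap w α := by
  simp only [constraintMap_apply, stateMap_mix hu hw hab]
  exact P.ψ_convex.2 (mem_univ _) (mem_univ _) ha hb hab

/-- A cheaper control with strictly negative constraints would be feasible, against optimality. -/
theorem IsL1Optimal.exists_fritzJohn (h : P.IsL1Optimal u x) :
    ∃ (η : ℝ) (κ : Measure P.Λ), 0 ≤ η ∧ IsFiniteMeasure κ ∧ η + κ.real univ = 1 ∧
      ∀ w, P.IsControl w → 0 ≤ η * (P.cost w - P.cost u) + ∫ α, P.constraintMap w α ∂κ := by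
  refine exists_fritzJohn_multiplier (adm := P.IsControl) ⟨u, h.1.toIsControlledPair.isControl⟩
    (fun v w hv hw a b ha hb hab => ⟨_, hv.mix hw ha hb hab, cost_mix_le hv hw ha hb hab,
      constraintMap_mix_le hv hw ha hb hab⟩) fun w hw hcost hG => ?_
  refine hcost.not_ge (h.2 w _ ⟨hw.isControlledPair, fun α hα => ?_⟩)
  have h1 := duhamel_eq_stateMap hw P.right_mem ⟨α, hα⟩
  show P.ψ _ ≤ 0
  rw [h1]
  exact (hG ⟨α, hα⟩).le

theorem continuous_gradient (P : Problem d ν) : Continuous (gradient P.ψ) :=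
  (InnerProductSpace.toDual ℝ (E d)).symm.continuous.comp
    (P.ψ_C1.continuous_fderiv one_ne_zero)

theorem integrable_of_continuous {F : Type*} [NormedAddCommGroup F] [NormedSpace ℝ F]
    {κ : Measure P.Λ} [IsFiniteMeasure κ]
    {f : P.Λ → F} (hf : Continuous f) : Integrable f κ :=
  hf.integrable_of_hasCompactSupport (HasCompactSupport.of_compactSpace _)

/-- The terminal costate. -/
def terminalCostate (P : Problem d ν) (u : ℝ → ℝ) (α : P.Λ) : E d :=
  -gradient P.ψ (P.stateMap u P.T α)

theorem continuous_terminalCostate : Continuous (P.terminalCostate u) :=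
  (P.continuous_gradient.comp (map_continuous (P.stateMap u P.T))).neg

/-- First order condition obtained from the Fritz John rule by linearization. -/
theorem linearized_nonneg {κ : Measure P.Λ} [IsFiniteMeasure κ] {η : ℝ} (hη : 0 ≤ η)
    (hu : P.IsControl u)
    (h : ∀ w, P.IsControl w → 0 ≤ η * (P.cost w - P.cost u) + ∫ α, P.constraintMap w α ∂κ)
    (h0 : ∫ α, P.constraintMap u α ∂κ ≤ 0) (hw : P.IsControl w) :
    0 ≤ η * (P.cost w - P.cost u) - ∫ α, inner ℝ (P.terminalCostate u α)
      (P.stateMap w P.T α - P.stateMap u P.T α) ∂κ := by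
  obtain ⟨y, hy⟩ : ∃ y, y = P.stateMap u P.T := ⟨_, rfl⟩
  obtain ⟨z, hz⟩ : ∃ z, z = P.stateMap w P.T := ⟨_, rfl⟩
  rw [← hy, ← hz]
  have hc : Continuous (Function.uncurry fun (s : ℝ) (α : P.Λ) =>
      (inner ℝ (gradient P.ψ (y α + s • (z α - y α))) (z α - y α) : ℝ)) := by
    have h1 := P.continuous_gradient
    simp only [Function.uncurry_def]
    fun_prop
  have hcont := continuous_parametric_integral_of_continuous (μ := κ) hc isCompact_univ
  rw [Measure.restrict_univ] at hcont
  have hG : ∀ v, Integrable (fun α => P.constraintMap v α) κ := fun v =>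
    integrable_of_continuous (P.constraintMap v).continuous
  -- The gradient inequality is used at the mixed point, bounding the increment of `ψ` from above by
  -- `s` times a gradient term. After division by `s`, continuity of the integral at `s = 0`
  -- replaces differentiation under it.
  have hs : ∀ s : ℝ, 0 < s → s ≤ 1 → 0 ≤ η * (P.cost w - P.cost u) +
      ∫ α, (inner ℝ (gradient P.ψ (y α + s • (z α - y α))) (z α - y α) : ℝ) ∂κ := by
    intro s hs hs1
    have hI : Integrable (fun α =>
        (inner ℝ (gradient P.ψ (y α + s • (z α - y α))) (z α - y α) : ℝ)) κ := by
      have h1 := P.continuous_gradient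
      exact integrable_of_continuous (by fun_prop)
    have h1 := h _ (hu.mix hw (sub_nonneg.2 hs1) hs.le (sub_add_cancel 1 s))
    have h2 := cost_mix_le hu hw (sub_nonneg.2 hs1) hs.le (sub_add_cancel 1 s)
    have hpt : ∀ α, P.constraintMap (fun t => (1 - s) * u t + s * w t) α ≤ P.constraintMap u α +
        s * (inner ℝ (gradient P.ψ (y α + s • (z α - y α))) (z α - y α) : ℝ) := by
      intro α
      have h4 : P.stateMap (fun t => (1 - s) * u t + s * w t) P.T α =
          y α + s • (z α - y α) := by
        rw [stateMap_mix hu hw (sub_add_cancel 1 s), ← hy, ← hz]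
        module
      have h5 := inner_gradient_le_sub P.ψ_convex
        ((P.ψ_C1.differentiable one_ne_zero) (y α + s • (z α - y α))) (y α)
      have h6 : y α - (y α + s • (z α - y α)) = -(s • (z α - y α)) := by abel
      rw [h6, inner_neg_right, real_inner_smul_right] at h5
      rw [constraintMap_apply, constraintMap_apply, h4, ← hy]
      linarith
    have h3 := integral_mono (hG _) ((hG u).add (hI.const_mul s)) hpt
    rw [integral_add' (hG u) (hI.const_mul s), integral_const_mul] at h3
    have h7 : η * (P.cost (fun t => (1 - s) * u t + s * w t) - P.cost u) ≤
        η * (s * (P.cost w - P.cost u)) := mul_le_mul_of_nonneg_left (by linarith) hη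
    refine nonneg_of_mul_nonneg_right (a := s) ?_ hs
    rw [mul_add]
    linarith
  have hlim : Filter.Tendsto (fun s : ℝ => η * (P.cost w - P.cost u) +
      ∫ α, (inner ℝ (gradient P.ψ (y α + s • (z α - y α))) (z α - y α) : ℝ) ∂κ)
      (nhdsWithin 0 (Ioi 0)) (nhds (η * (P.cost w - P.cost u) +
      ∫ α, (inner ℝ (gradient P.ψ (y α + (0 : ℝ) • (z α - y α))) (z α - y α) : ℝ) ∂κ)) :=
    ((continuous_const.add hcont).tendsto 0).mono_left nhdsWithin_le_nhds
  have hge := ge_of_tendsto hlim (b := 0) (by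
    filter_upwards [Ioc_mem_nhdsGT (zero_lt_one (α := ℝ))] with s hs' using hs s hs'.1 hs'.2)
  simp only [zero_smul, add_zero] at hge
  simp only [terminalCostate, ← hy, inner_neg_left, integral_neg, sub_neg_eq_add]
  exact hge

/-- The first variation of the terminal state is an integral against the switching function. -/
theorem integral_inner_variation (hu : P.IsControl u) (hw : P.IsControl w) {κ : Measure P.Λ}
    {q : P.Λ → E d} (hq : Integrable q κ) :
    ∫ α, inner ℝ (q α) (P.stateMap w P.T α - P.stateMap u P.T α) ∂κ =
      ∫ t in (0 : ℝ)..P.T,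
        (w t - u t) * pairing hq P.inputMap (NormedSpace.exp ((P.T - t) • P.opMap)) := by
  have h1 := hu.intervalIntegrable P.right_mem
  have h2 := hw.intervalIntegrable P.right_mem
  have h3 : ∫ α, inner ℝ (q α) (P.stateMap w P.T α - P.stateMap u P.T α) ∂κ =
      pairing hq P.inputMap (NormedSpace.exp (P.T • P.opMap) *
        (P.reach w P.T - P.reach u P.T)) := by
    rw [pairing_apply]
    congr 1 with α
    have h4 : (NormedSpace.exp (P.T • P.opMap) * (P.reach w P.T - P.reach u P.T)) α (P.inputMap α) =
      NormedSpace.exp (P.T • P.opMap) α (P.reach w P.T α (P.b α) - P.reach u P.T α (P.b α)) := rfl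
    rw [h4, stateMap_apply, stateMap_apply, ← map_sub, add_sub_add_left_eq_sub]
  have h5 : pairing hq P.inputMap (NormedSpace.exp (P.T • P.opMap) *
      (P.reach w P.T - P.reach u P.T)) = ((pairing hq P.inputMap).comp
        (ContinuousLinearMap.mul ℝ P.OpAlg (NormedSpace.exp (P.T • P.opMap))))
          (P.reach w P.T - P.reach u P.T) := rfl
  rw [h3, h5, reach, reach, ← intervalIntegral.integral_sub h2 h1,
    ← ContinuousLinearMap.intervalIntegral_comp_comm _ (h2.sub h1)]
  refine intervalIntegral.integral_congr fun t _ => ?_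
  let +nondep : NormedAlgebra ℚ P.OpAlg := .restrictScalars ℚ ℝ _
  have h6 : NormedSpace.exp ((P.T - t) • P.opMap) =
      NormedSpace.exp (P.T • P.opMap) * NormedSpace.exp ((-t) • P.opMap) := by
    rw [← NormedSpace.exp_add_of_commute, ← add_smul, sub_eq_add_neg]
    exact ((Commute.refl _).smul_left _).smul_right _
  simp only [← sub_smul, map_smul, smul_eq_mul, h6]
  rfl

/-- The function `φ v - η|v|` is linear on `[-1,0]` and `[0,1]` with slopes `φ + η` and `φ - η`,
whose signs select the maximizer. -/
theorem deadzone_isMax {φ η v : ℝ} (hη : 0 ≤ η) (hv : v ∈ Icc (-1 : ℝ) 1) :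
    φ * v - η * |v| ≤ φ * (if η < φ then 1 else if φ < -η then -1 else 0) -
      η * |(if η < φ then 1 else if φ < -η then -1 else 0 : ℝ)| := by
  obtain ⟨h1, h2⟩ := hv
  have h3 := le_abs_self v
  have h4 := neg_abs_le v
  have h5 : |v| ≤ 1 := abs_le.2 ⟨h1, h2⟩
  have h0 := abs_nonneg v
  split_ifs with h h'
  · rw [abs_one]; nlinarith
  · rw [abs_neg, abs_one]; nlinarith
  · rw [abs_zero]
    have h6 : |φ| ≤ η := abs_le.2 ⟨not_lt.1 h', not_lt.1 h⟩
    have h7 : φ * v ≤ |φ| * |v| := by rw [← abs_mul]; exact le_abs_self _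
    nlinarith

/-- Pointwise maximization from the integrated first order condition. -/
theorem ae_maximizes {φ : ℝ → ℝ} (hφ : Continuous φ) {η : ℝ} (hη : 0 ≤ η) (hu : P.IsControl u)
    (h : ∀ w, P.IsControl w →
      0 ≤ η * (P.cost w - P.cost u) - ∫ t in (0 : ℝ)..P.T, (w t - u t) * φ t) :
    ∀ᵐ t ∂P.timeMeasure, ∀ v ∈ Icc (-1 : ℝ) 1,
      φ t * v - η * |v| ≤ φ t * u t - η * |u t| := by
  -- This competitor maximizes at every `t` and is explicitly measurable. The gap to `u` is
  -- nonnegative with nonpositive integral, hence zero a.e.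
  set w : ℝ → ℝ := fun t => if η < φ t then 1 else if φ t < -η then -1 else 0 with hw
  have hwm : Measurable w := Measurable.ite (measurableSet_lt measurable_const hφ.measurable)
    measurable_const (Measurable.ite (measurableSet_lt hφ.measurable measurable_const)
      measurable_const measurable_const)
  have hwc : P.IsControl w := ⟨hwm.aestronglyMeasurable, Filter.Eventually.of_forall fun t => by
    simp only [hw]; split_ifs <;> simp⟩
  have hmul : ∀ {v : ℝ → ℝ}, P.IsControl v →
      IntervalIntegrable (fun t => φ t * v t) volume 0 P.T := fun hv => by
    simpa only [smul_eq_mul, mul_comm] using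
      intervalIntegrable_smul_of_control P.T_pos.le hv.1 hv.2 hφ
  have hI : ∀ {v : ℝ → ℝ}, P.IsControl v →
      IntervalIntegrable (fun t => φ t * v t - η * |v t|) volume 0 P.T := fun hv =>
    (hmul hv).sub (hv.integrable.abs.const_mul η)
  have hg : IntervalIntegrable (fun t => (φ t * w t - η * |w t|) - (φ t * u t - η * |u t|))
      volume 0 P.T := (hI hwc).sub (hI hu)
  have hnn : 0 ≤ᵐ[volume.restrict (Ioc 0 P.T)]
      fun t => (φ t * w t - η * |w t|) - (φ t * u t - η * |u t|) := by
    refine ae_restrict_of_ae_restrict_of_subset Ioc_subset_Icc_self ?_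
    filter_upwards [hu.2] with t ht
    exact sub_nonneg.2 (deadzone_isMax hη ht)
  have hle : ∫ t in (0 : ℝ)..P.T, ((φ t * w t - η * |w t|) - (φ t * u t - η * |u t|)) ≤ 0 := by
    have h1 := h w hwc
    have h2 : ∫ t in (0 : ℝ)..P.T, ((φ t * w t - η * |w t|) - (φ t * u t - η * |u t|)) =
        (∫ t in (0 : ℝ)..P.T, (w t - u t) * φ t) - η * (P.cost w - P.cost u) := by
      have h3 : ∀ t, (φ t * w t - η * |w t|) - (φ t * u t - η * |u t|) =
          (φ t * w t - φ t * u t) - (η * |w t| - η * |u t|) := fun t => by ring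
      have h4 : ∀ t, (w t - u t) * φ t = φ t * w t - φ t * u t := fun t => by ring
      simp only [h3, h4]
      rw [intervalIntegral.integral_sub ((hmul hwc).sub (hmul hu))
        ((hwc.integrable.abs.const_mul η).sub (hu.integrable.abs.const_mul η)),
        intervalIntegral.integral_sub (hwc.integrable.abs.const_mul η)
          (hu.integrable.abs.const_mul η), intervalIntegral.integral_const_mul,
        intervalIntegral.integral_const_mul, cost, cost]
      ring
    linarith
  rw [intervalIntegral.integral_of_le P.T_pos.le] at hle
  have hzero := (integral_eq_zero_iff_of_nonneg_ae hnn hg.1).1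
    (hle.antisymm (integral_nonneg_of_ae hnn))
  rw [timeMeasure, ← restrict_Ioc_eq_restrict_Icc]
  filter_upwards [hzero] with t ht v hv
  have h1 := deadzone_isMax (φ := φ t) hη hv
  simp only [Pi.zero_apply] at ht
  linarith

variable (P) in
open Classical in
/-- The costate arcs that start from `-∇ψ` on the active set. -/
def costate (x : E ν → ℝ → E d) (α : E ν) (t : ℝ) : E d :=
  if α ∈ P.activeSet x then
    NormedSpace.exp ((P.T - t) • Matrix.toEuclideanCLM (𝕜 := ℝ) (P.A α).transpose)
      (-gradient P.ψ (x α P.T))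
  else 0

theorem costate_of_mem {α : E ν} (hα : α ∈ P.activeSet x) : P.costate x α = fun t =>
    NormedSpace.exp ((P.T - t) • Matrix.toEuclideanCLM (𝕜 := ℝ) (P.A α).transpose)
      (-gradient P.ψ (x α P.T)) :=
  funext fun _ => if_pos hα

theorem costate_terminal {α : E ν} (hα : α ∈ P.activeSet x) :
    P.costate x α P.T = -gradient P.ψ (x α P.T) := by
  rw [costate_of_mem hα]
  simp only [sub_self]
  exact congrArg (fun M : E d →L[ℝ] E d => M (-gradient P.ψ (x α P.T)))
    (exp_zero_smul (Matrix.toEuclideanCLM (𝕜 := ℝ) (P.A α).transpose))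

theorem costate_ac {α : E ν} (hα : α ∈ P.activeSet x) :
    AbsolutelyContinuousOnInterval (P.costate x α) 0 P.T := by
  rw [costate_of_mem hα]
  refine ContDiffOn.absolutelyContinuousOnInterval (ContDiff.contDiffOn ?_)
  exact ((contDiff_exp_smul _).comp (contDiff_const.sub contDiff_id)).clm_apply contDiff_const

theorem costate_hasDerivAt {α : E ν} (hα : α ∈ P.activeSet x) (t : ℝ) :
    HasDerivAt (P.costate x α)
      (-(Matrix.toEuclideanCLM (𝕜 := ℝ) (P.A α).transpose (P.costate x α t))) t := by
  rw [costate_of_mem hα]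
  have h1 := (hasDerivAt_exp_smul_const'
    (Matrix.toEuclideanCLM (𝕜 := ℝ) (P.A α).transpose) (P.T - t)).scomp t
      ((hasDerivAt_id t).const_sub P.T)
  refine (h1.clm_apply (hasDerivAt_const t (-gradient P.ψ (x α P.T)))).congr_deriv ?_
  simp

theorem isClosed_activeSet (hx : P.IsControlledPair u x) : IsClosed (P.activeSet x) := by
  have h1 : P.activeSet x = Subtype.val '' {α : P.Λ | P.constraintMap u α = 0} := by
    ext α
    constructor
    · rintro ⟨h, h'⟩
      refine ⟨⟨α, h⟩, ?_, rfl⟩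
      rw [mem_ofPred_eq, constraintMap_apply, ← hx.eq_stateMap P.right_mem]
      exact h'
    · rintro ⟨β, h, rfl⟩
      rw [mem_ofPred_eq, constraintMap_apply, ← hx.eq_stateMap P.right_mem] at h
      exact ⟨β.2, h⟩
  rw [h1]
  exact P.Λ_compact.isClosed.isClosedEmbedding_subtypeVal.isClosedMap _
    (isClosed_eq (map_continuous _) continuous_const)

/-- The robust maximum principle. -/
theorem IsL1Optimal.exists_isMultiplier (hopt : P.IsL1Optimal u x) :
    ∃ (η : ℝ) (lam : Measure (E ν)) (p : E ν → ℝ → E d), P.IsMultiplier u x η lam p := by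
  obtain ⟨η, κ, hη, hκ, hnorm, hFJ⟩ := hopt.exists_fritzJohn
  have hx := hopt.1.toIsControlledPair
  have hu := hx.isControl
  have hemb : MeasurableEmbedding (Subtype.val : P.Λ → E ν) :=
    MeasurableEmbedding.subtype_coe P.Λ_compact.measurableSet
  set lam := Measure.map (Subtype.val : P.Λ → E ν) κ with hlam
  have hG : ∀ α, P.constraintMap u α ≤ 0 := fun α => by
    rw [constraintMap_apply, ← hx.eq_stateMap P.right_mem]
    exact hopt.1.terminal α α.2
  -- Feasibility gives one sign and the Fritz John inequality at `w = u` the other; complementarity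
  -- follows.
  have hG0 : ∫ α, P.constraintMap u α ∂κ = 0 :=
    (integral_nonpos fun α => hG α).antisymm (by simpa using hFJ u hu)
  have hactκ : ∀ᵐ α : P.Λ ∂κ, (α : E ν) ∈ P.activeSet x := by
    have h1 := (integral_eq_zero_iff_of_nonneg (μ := κ) (f := fun α => -P.constraintMap u α)
      (fun α => neg_nonneg.2 (hG α))
      (integrable_of_continuous (P.constraintMap u).continuous).neg).1 (by
        rw [integral_neg, hG0, neg_zero])
    filter_upwards [h1] with α hα
    refine ⟨α.2, ?_⟩
    rw [hx.eq_stateMap P.right_mem]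
    exact neg_eq_zero.1 hα
  have hact : ∀ᵐ α ∂lam, α ∈ P.activeSet x := by
    rw [hlam, hemb.ae_map_iff]
    exact hactκ
  have hfin : IsFiniteMeasure lam := by rw [hlam]; infer_instance
  have hpq : ∀ᵐ α : P.Λ ∂κ, P.costate x α P.T = P.terminalCostate u α := by
    filter_upwards [hactκ] with α hα
    rw [costate_terminal hα, terminalCostate, hx.eq_stateMap P.right_mem]
  have hq : Integrable (P.terminalCostate u) κ :=
    integrable_of_continuous continuous_terminalCostate
  have hint : Integrable (fun α => P.costate x α P.T) lam := by
    rw [hlam, hemb.integrable_map_iff]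
    exact hq.congr (hpq.mono fun α hα => hα.symm)
  have hcostate : P.IsCostate lam (P.costate x) :=
    ⟨hact.mono fun α hα => costate_ac hα, hint,
      hact.mono fun α hα => Filter.Eventually.of_forall fun t => costate_hasDerivAt hα t⟩
  have hsw : ∀ t ∈ Icc 0 P.T, P.switching lam (P.costate x) t =
      pairing hq P.inputMap (NormedSpace.exp ((P.T - t) • P.opMap)) := by
    intro t ht
    rw [hcostate.switching_eq ht, pairing_apply, pairing_apply, hlam, hemb.comap_map]
    refine integral_congr_ae ?_
    filter_upwards [hpq] with α hα
    rw [hα]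
  have hmax := ae_maximizes
    (φ := fun t => pairing hq P.inputMap (NormedSpace.exp ((P.T - t) • P.opMap)))
    (((pairing hq P.inputMap).continuous.comp
      (continuous_exp_smul P.opMap)).comp (continuous_const.sub continuous_id)) hη hu
    (fun w hw => by
      have h1 := linearized_nonneg hη hu hFJ hG0.le hw
      rw [integral_inner_variation hu hw hq] at h1
      exact h1)
  have hreal : lam.real P.Λ = κ.real univ := by
    rw [hlam, measureReal_def, hemb.map_apply, Subtype.coe_preimage_self, measureReal_def]
  have hκ0 : 0 ≤ κ.real univ := measureReal_nonneg
  refine ⟨η, lam, P.costate x, ⟨⟨hη, by linarith⟩, hfin, ?_, by rw [hreal, hnorm], hcostate.ac,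
    hcostate.integrable, hcostate.adjoint, ?_, ?_, ?_⟩⟩
  · rw [hlam, hemb.map_apply]
    simp
  · filter_upwards [hact] with α hα
    -- The measure already carries the weights, so `μ = 1` on the active set.
    refine ⟨1, zero_le_one, ?_, fun _ => hα.2⟩
    rw [costate_terminal hα, neg_neg, one_smul]
  -- A closed set of full measure contains the support; closedness rests on continuity of the
  -- terminal state in `α`.
  · exact Measure.support_subset_of_isClosed (isClosed_activeSet hx) hact
  · filter_upwards [hmax, hu.2, ae_restrict_mem measurableSet_Icc] with t h1 h2 ht
    refine ⟨h2, fun v hv => ?_⟩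
    obtain ⟨K, hK⟩ := hcostate.exists_hamiltonian_eq hx ht
    have h3 := h1 v hv
    simp only [mem_ofPred_eq, hK, hsw t ht]
    linarith

end Problem

end RobustHandsOff

end

theorem mainTheorem3 {d ν : ℕ} (P : RobustHandsOff.Problem d ν)
    (u : ℝ → ℝ) (x : RobustHandsOff.E ν → ℝ → RobustHandsOff.E d)
    (hopt : P.IsL1Optimal u x) :
    (∃ (η : ℝ) (lam : Measure (RobustHandsOff.E ν))
        (p : RobustHandsOff.E ν → ℝ → RobustHandsOff.E d), P.IsMultiplier u x η lam p) ∧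
    ∀ (η : ℝ) (lam : Measure (RobustHandsOff.E ν))
      (p : RobustHandsOff.E ν → ℝ → RobustHandsOff.E d),
      P.IsMultiplier u x η lam p → 0 < η → P.AveragedControllability x lam →
      ∀ᵐ t ∂P.timeMeasure,
        |P.switching lam p t| ≠ η ∧
        (η < P.switching lam p t → u t = 1) ∧
        (|P.switching lam p t| < η → u t = 0) ∧
        (P.switching lam p t < -η → u t = -1) := by
  exact ⟨hopt.exists_isMultiplier,
    fun _ _ _ h hη hc => h.bang_off_bang hopt.1.toIsControlledPair hη hc⟩
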